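/- Let $N\ge 1$ and $K\ge 1$ be integers. A locally decodable code (LDC) with locality $N$ and length $M$ consists of $K$ independent random source symbols $W_1,\dots,W_K$ with finite alphabets and $H(W_1)=\cdots=H(W_K)=L_w$ bits; a deterministic map of $(W_1,\dots,W_K)$ to $M$ coded symbols $X_1,\dots,X_M$ with finite alphabets and $H(X_1)=\cdots=H(X_M)=L_x$ bits; and, for each $k$, a non-empty family $\mathcal S_k$ of $N$-element sets $S$ of coded symbols (the decoding sets of $W_k$) with $H(W_k\mid S)=0$. It is universal (a ULDC) if for each $k$ every coded symbol lies in some $S\in\mathcal S_k$, and perfectly smooth (an SLDC) if for each $k$ all coded symbols lie in the same number of sets $S\in\mathcal S_k$. Its symbol rate is $L_w/L_x$ (for $L_x>0$). Let $C(N,K,M)$ be the supremum of the symbol rates of ULDCs with locality $N$, $K$ source symbols and length $M$ ($0$ if there are none), and let $C^*(N,K)=\sup_M C(N,K,M)$. Then $$C^*(N,K)=N\left(1+\tfrac1N+\cdots+\tfrac1{N^{K-1}}\right)^{-1},\qquad \min\{M\mid C(N,K,M)=C^*(N,K)\}=N^K,$$ and $N^K$ is also the smallest $M$ for which there is a ULDC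 of length $M$ whose symbol rate equals $C^*(N,K)$. Moreover: (a) Consider a ULDC with symbol rate $C^*(N,K)$ and a permutation $\pi$ of $\{1,\dots,K\}$, and label the nodes of the full $N$-ary tree of depth $K$ by coded symbols in such a way that, for $1\le d\le K$, the labels of the $N$ children of each node at depth $d-1$ form a decoding set of $W_{\pi(d)}$ that contains the label of that node. Then the labels of the $N^K$ leaves are distinct coded symbols, and $H(X\mid X')\ne 0$ for the labels $X,X'$ of any two different leaves. (b) If $N\ge 2$, there is an SLDC (which is also universal) of length $N^K$ with symbol rate $C^*(N,K)$ in which the source symbols are independent uniform strings of $L_w=N^K(N-1)$ bits and the coded symbols are $\mathbb F_2$-linear functions of the source symbols with values in the strings of $L_x=N^K-1$ bits. -/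

import Mathlib

open scoped ENNReal

noncomputable section

/-- Shannon entropy, in bits, of a random variable `X` with a finite alphabet. -/
def entropy {Ω β : Type} [Fintype β] (P : PMF Ω) (X : Ω → β) : ℝ :=
  ∑ b, Real.negMulLog ((P.map X) b).toReal / Real.log 2

/-- Conditional entropy `H(X | Y) = H(X, Y) - H(Y)`, in bits. -/
def condEntropy {Ω β γ : Type} [Fintype β] [Fintype γ] (P : PMF Ω) (X : Ω → β) (Y : Ω → γ) : ℝ :=
  entropy P (fun ω => (X ω, Y ω)) - entropy P Y

/-- The data of a code: `K` random source symbols `W_k` with finite alphabets and joint law `law`,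
a map that produces `M` coded symbols `X_m` with finite alphabets out of the source symbols, and,
for every source symbol, a family of sets of (indices of) coded symbols. -/
structure Code (K M : ℕ) where
  /-- alphabet of the source symbol `W_k` -/
  srcAlph : Fin K → Type
  /-- source alphabets are finite -/
  srcFin : ∀ k, Fintype (srcAlph k)
  /-- joint law of `(W_1, …, W_K)` -/
  law : PMF (∀ k, srcAlph k)
  /-- alphabet of the coded symbol `X_m` -/
  codAlph : Fin M → Type
  /-- coded alphabets are finite -/
  codFin : ∀ m, Fintype (codAlph m)
  /-- the encoder -/
  enc : ∀ m, (∀ k, srcAlph k) → codAlph m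
  /-- the decoding supersets -/
  dec : Fin K → Finset (Finset (Fin M))

attribute [instance] Code.srcFin Code.codFin

namespace Code

variable {K M : ℕ}

/-- `X_S`, the tuple of the coded symbols with index in `S`. -/
def tuple (c : Code K M) (S : Finset (Fin M)) (w : ∀ k, c.srcAlph k) : ∀ m : S, c.codAlph m :=
  fun m => c.enc m w

/-- The code is a locally decodable code with locality `N`, whose source symbols are independent
of size `Lw` bits and whose coded symbols have size `Lx` bits. -/
structure IsLDC (c : Code K M) (N : ℕ) (Lw Lx : ℝ) : Prop where
  /-- `H(W_1, …, W_K) = H(W_1) + ⋯ + H(W_K)` -/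
  indep : entropy c.law (fun w => w) = ∑ k, entropy c.law (fun w => w k)
  /-- `H(W_k) = Lw` -/
  source_size : ∀ k, entropy c.law (fun w => w k) = Lw
  /-- `H(X_m) = Lx` -/
  coded_size : ∀ m, entropy c.law (c.enc m) = Lx
  /-- the decoding supersets are not empty -/
  dec_nonempty : ∀ k, (c.dec k).Nonempty
  /-- decoding sets have `N` elements -/
  dec_card : ∀ k, ∀ S ∈ c.dec k, S.card = N
  /-- `H(W_k | X_S) = 0` -/
  decodable : ∀ k, ∀ S ∈ c.dec k, condEntropy c.law (fun w => w k) (c.tuple S) = 0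

/-- Universality: every coded symbol lies in some decoding set of every source symbol. -/
def IsUniversal (c : Code K M) : Prop :=
  ∀ m k, ∃ S ∈ c.dec k, m ∈ S

/-- Perfect smoothness: all coded symbols lie in equally many decoding sets of each source
symbol. -/
def IsSmooth (c : Code K M) : Prop :=
  ∀ m m' k, ((c.dec k).filter (fun S => m ∈ S)).card = ((c.dec k).filter (fun S => m' ∈ S)).card

/-- A labelling of the nodes of the full `N`-ary tree of depth `K` by coded symbols is a decoding
tree for the order `π` of the source symbols if the labels of the children of each node at depth
`d < K` form a decoding set of `W_{π d}` that contains the label of the node itself. A node at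
depth `d` is the list of the `d` choices on the way to it, last choice first; the root is `[]`, the
leaves are the lists of length `K`. -/
def IsDecodingTree (c : Code K M) {N : ℕ} (π : Equiv.Perm (Fin K))
    (label : List (Fin N) → Fin M) : Prop :=
  ∀ (v : List (Fin N)) (h : v.length < K),
    Finset.univ.image (fun n => label (n :: v)) ∈ c.dec (π ⟨v.length, h⟩) ∧
      ∃ n, label (n :: v) = label v

/-- The code with i.i.d. uniform source symbols of `a` bits and coded symbols that are strings of
`b` bits, given by linear maps over the field with two elements. -/
def linear {a b : ℕ} (E : Fin M → (Fin K → Fin a → ZMod 2) →ₗ[ZMod 2] (Fin b → ZMod 2))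
    (dec : Fin K → Finset (Finset (Fin M))) : Code K M where
  srcAlph := fun _ => Fin a → ZMod 2
  srcFin := fun _ => inferInstance
  law := PMF.uniformOfFintype (Fin K → Fin a → ZMod 2)
  codAlph := fun _ => Fin b → ZMod 2
  codFin := fun _ => inferInstance
  enc := fun m w => E m w
  dec := dec

end Code

/-- `R` is the symbol rate `Lw / Lx` of some universal LDC with locality `N`, `K` source symbols
and length `M`. (If `Lx = 0` the rate is undefined.) -/
def IsULDCRate (N K M : ℕ) (R : ℝ) : Prop :=
  ∃ (c : Code K M) (Lw Lx : ℝ), c.IsLDC N Lw Lx ∧ c.IsUniversal ∧ 0 < Lx ∧ R = Lw / Lx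

/-- The capacity of the class of universal LDCs with locality `N`, `K` source symbols and length
`M`: the supremum of the symbol rates (`0` if the class is empty). -/
def uldcCapacity (N K M : ℕ) : ℝ≥0∞ :=
  sSup {r | ∃ R : ℝ, IsULDCRate N K M R ∧ r = ENNReal.ofReal R}

/-- The largest capacity over all lengths. -/
def uldcMaxCapacity (N K : ℕ) : ℝ≥0∞ :=
  ⨆ M : ℕ, uldcCapacity N K M

end

/-!
The upper bound is Shannon-type. Write `b 0 = Lx` and `b (j + 1) = N * b j - Lw`. A decoding set of
`W_k` that contains the coded symbol `X_m` has at most `N * b j` bits given `j` other source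
symbols, and `Lw` of them are those of `W_k`; by induction `H(X_m | W_A) ≤ b |A|` for all `m` and
`A` (`Code.IsLDC.codedEntropy_le_entropyBound`). In particular the gap `δ = b K` is nonnegative,
which is the bound on the rate. Going back from `|A| = K`, where the entropy is `0`, the same step
gives `H(X_m | W_A) ≥ b |A| - δ` (`Code.IsLDC.entropyBound_sub_le_codedEntropy`): all these
inequalities are tight up to `δ`.

In a decoding tree this means that, up to multiples of `δ`, a node determines its descendants given
the source symbols `W_A` decoded below it (`Code.IsLDC.codedEntropy_descendant_le`), that conversely
a leaf determines its ancestors, since all of them have about `b |A|` bits given `W_A`, and that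
siblings are independent given `W_A` (`Code.IsLDC.two_mul_entropyBound_le`). If a leaf were a
function of another one, then their ancestors just below the point where the branches part would be
independent and functions of the same leaf. As these ancestors have at least `Lw / N` bits, it
follows that `Lw ≤ N * (2 * K + 1) * δ`
(`Code.IsLDC.source_size_le_of_condEntropy_eq_zero`). For a code that achieves the capacity this
contradicts `δ = 0`. For a code of length below `N ^ K` two leaves have the same label, so the
explicit lower bound on `δ` keeps the rates of all these codes away from the capacity
(`uldcCapacity_lt`); this uniformity is needed as the capacity of a given length is a supremum.

The code that achieves the capacity (`Code.exists_linear_smooth`) has its coded symbols indexed by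
`q ∈ (ZMod N) ^ K`. In a single copy, `W_k` is a function `ZMod N → ZMod 2` with `W_k 0 = 0`, and
the symbol at `q` is the bit `∑ k, W_k (q k)`; the `N` points of a line in direction `k` give `W_k`,
because the value where the coordinate `k` vanishes can be subtracted. At `q = 0` this bit is `0`.
Taking one copy for each translate of the index set makes all coded symbols equally long, with
`N ^ K - 1` independent bits each.
-/

/-! ### Shannon entropy -/

section Entropy

variable {Ω α β γ : Type} [Fintype α]

open Classical in
lemma PMF.toReal_map_comp_apply (P : PMF Ω) (X : Ω → α) (f : α → β) (b : β) :
    ((P.map (f ∘ X)) b).toReal = ∑ a, if b = f a then ((P.map X) a).toReal else 0 := by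
  rw [← PMF.map_comp, PMF.map_apply, tsum_fintype, ENNReal.toReal_sum]
  · refine Finset.sum_congr rfl fun a _ => ?_
    split_ifs <;> simp
  · intro a _
    split_ifs
    · exact PMF.apply_ne_top _ _
    · simp

variable [Fintype β] [Fintype γ] (P : PMF Ω)

lemma entropy_comp_le (X : Ω → α) (f : α → β) : entropy P (f ∘ X) ≤ entropy P X := by
  classical
  set p : α → ℝ := fun a => ((P.map X) a).toReal with hp
  have hp0 : ∀ a, 0 ≤ p a := fun a => ENNReal.toReal_nonneg
  have hl : (0 : ℝ) < Real.log 2 := Real.log_pos one_lt_two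
  have key : ∀ b, Real.negMulLog (∑ a, if b = f a then p a else 0)
      ≤ ∑ a, if b = f a then Real.negMulLog (p a) else 0 := by
    intro b
    set s := ∑ a, if b = f a then p a else 0 with hs
    have : Real.negMulLog s = ∑ a, if b = f a then - p a * Real.log s else 0 := by
      rw [Real.negMulLog, hs, ← Finset.sum_neg_distrib, Finset.sum_mul]
      refine Finset.sum_congr rfl fun a _ => ?_
      split_ifs <;> simp
    rw [this]
    refine Finset.sum_le_sum fun a _ => ?_
    split_ifs with hba
    · rcases (hp0 a).eq_or_lt with h0 | h0
      · simp [Real.negMulLog, ← h0]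
      · have hle : p a ≤ s := by
          have := Finset.single_le_sum (f := fun a => if b = f a then p a else 0)
            (fun i _ => by by_cases hi : b = f i <;> simp [hi, hp0])
            (Finset.mem_univ a)
          rwa [if_pos hba] at this
        have := Real.log_le_log h0 hle
        rw [Real.negMulLog]
        nlinarith
    · exact le_rfl
  rw [entropy, entropy, ← Finset.sum_div, ← Finset.sum_div]
  refine div_le_div_of_nonneg_right ?_ hl.le
  calc ∑ b, Real.negMulLog ((P.map (f ∘ X)) b).toReal
      ≤ ∑ b, ∑ a, if b = f a then Real.negMulLog (p a) else 0 := by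
        refine Finset.sum_le_sum fun b _ => ?_
        rw [P.toReal_map_comp_apply]
        exact key b
    _ = ∑ a, Real.negMulLog (p a) := by
        rw [Finset.sum_comm]
        simp

/-- A random variable that is determined by another one has at most the entropy of the latter. -/
lemma entropy_le_of_determined (X : Ω → α) (Y : Ω → β)
    (h : ∀ ω ω', Y ω = Y ω' → X ω = X ω') : entropy P X ≤ entropy P Y := by
  obtain ⟨ω₀, -⟩ := P.support_nonempty
  have : Nonempty α := ⟨X ω₀⟩
  have hf : Function.FactorsThrough X Y := fun ω ω' hω => h ω ω' hω
  have hX : X = (Function.extend Y X fun _ => Classical.arbitrary α) ∘ Y := by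
    funext ω
    exact (hf.extend_apply _ ω).symm
  rw [hX]
  exact entropy_comp_le P Y _

lemma entropy_congr_of_determined (X : Ω → α) (Y : Ω → β)
    (h : ∀ ω ω', Y ω = Y ω' ↔ X ω = X ω') : entropy P X = entropy P Y :=
  le_antisymm (entropy_le_of_determined P X Y fun ω ω' => (h ω ω').1)
    (entropy_le_of_determined P Y X fun ω ω' => (h ω ω').2)

lemma condEntropy_eq_zero_of_determined (X : Ω → α) (Y : Ω → β)
    (h : ∀ ω ω', Y ω = Y ω' → X ω = X ω') : condEntropy P X Y = 0 := by
  rw [condEntropy, sub_eq_zero]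
  refine entropy_congr_of_determined P _ _ fun ω ω' => ?_
  rw [Prod.mk.injEq]
  exact ⟨fun hY => ⟨h ω ω' hY, hY⟩, And.right⟩

lemma entropy_const (a : α) : entropy P (fun _ : Ω => a) = 0 := by
  classical
  refine Finset.sum_eq_zero fun b _ => ?_
  rw [show (P.map fun _ => a) = PMF.pure a from PMF.map_const P a, PMF.pure_apply]
  split_ifs <;> simp

lemma entropy_eq_zero_of_subsingleton [Subsingleton α] (X : Ω → α) : entropy P X = 0 := by
  obtain ⟨ω₀, -⟩ := P.support_nonempty
  rw [show X = fun _ => X ω₀ from funext fun ω => Subsingleton.elim _ _]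
  exact entropy_const P _

/-- The inequality `∑ p log (p c / (a b)) ≥ 0` for a nonnegative array `p` with marginals
`a`, `b`, `c`, in the form of a comparison of sums of `negMulLog`. -/
lemma sum_negMulLog_submodular (p : α → β → γ → ℝ) (hp : ∀ x y z, 0 ≤ p x y z) :
    (∑ x, ∑ y, ∑ z, Real.negMulLog (p x y z)) + ∑ z, Real.negMulLog (∑ x, ∑ y, p x y z)
      ≤ (∑ x, ∑ z, Real.negMulLog (∑ y, p x y z))
        + ∑ y, ∑ z, Real.negMulLog (∑ x, p x y z) := by
  set a : α → γ → ℝ := fun x z => ∑ y, p x y z with ha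
  set b : β → γ → ℝ := fun y z => ∑ x, p x y z with hb
  set c : γ → ℝ := fun z => ∑ x, ∑ y, p x y z with hc
  have ha0 : ∀ x z, 0 ≤ a x z := fun x z => Finset.sum_nonneg fun y _ => hp x y z
  have hb0 : ∀ y z, 0 ≤ b y z := fun y z => Finset.sum_nonneg fun x _ => hp x y z
  have hc0 : ∀ z, 0 ≤ c z := fun z => Finset.sum_nonneg fun x _ => ha0 x z
  have hpa : ∀ x y z, p x y z ≤ a x z := fun x y z =>
    Finset.single_le_sum (f := fun y => p x y z) (fun y _ => hp x y z) (Finset.mem_univ y)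
  have hpb : ∀ x y z, p x y z ≤ b y z := fun x y z =>
    Finset.single_le_sum (f := fun x => p x y z) (fun x _ => hp x y z) (Finset.mem_univ x)
  have hac : ∀ x z, a x z ≤ c z := fun x z =>
    Finset.single_le_sum (f := fun x => a x z) (fun x _ => ha0 x z) (Finset.mem_univ x)
  have hcb : ∀ z, ∑ y, b y z = c z := fun z => Finset.sum_comm
  have key : ∀ x y z, p x y z * (Real.log (a x z) + Real.log (b y z)
      - Real.log (p x y z) - Real.log (c z)) ≤ a x z * b y z / c z - p x y z := by
    intro x y z
    rcases (hp x y z).eq_or_lt with h0 | h0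
    · rw [← h0]
      simpa using div_nonneg (mul_nonneg (ha0 x z) (hb0 y z)) (hc0 z)
    · have h1 : 0 < a x z := h0.trans_le (hpa x y z)
      have h2 : 0 < b y z := h0.trans_le (hpb x y z)
      have h3 : 0 < c z := h1.trans_le (hac x z)
      have h4 := Real.log_le_sub_one_of_pos (x := a x z * b y z / (p x y z * c z)) (by positivity)
      rw [Real.log_div (by positivity) (by positivity), Real.log_mul h1.ne' h2.ne',
        Real.log_mul h0.ne' h3.ne'] at h4
      calc _ = p x y z * (Real.log (a x z) + Real.log (b y z)
            - (Real.log (p x y z) + Real.log (c z))) := by ring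
        _ ≤ p x y z * (a x z * b y z / (p x y z * c z) - 1) :=
            mul_le_mul_of_nonneg_left h4 h0.le
        _ = _ := by field_simp
  have hsum : ∑ x, ∑ y, ∑ z, p x y z * (Real.log (a x z) + Real.log (b y z)
      - Real.log (p x y z) - Real.log (c z)) ≤ 0 := by
    refine (Finset.sum_le_sum fun x _ => Finset.sum_le_sum fun y _ =>
      Finset.sum_le_sum fun z _ => key x y z).trans ?_
    simp only [Finset.sum_sub_distrib]
    have e1 : ∑ x, ∑ y, ∑ z, a x z * b y z / c z = ∑ z, c z := by
      have : ∀ z, ∑ x, ∑ y, a x z * b y z / c z = c z := by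
        intro z
        simp only [← Finset.sum_div, ← Finset.mul_sum, hcb, ← Finset.sum_mul]
        exact mul_self_div_self (c z)
      rw [← Finset.sum_congr rfl fun z _ => this z, Finset.sum_comm (s := Finset.univ (α := γ))]
      exact Finset.sum_congr rfl fun x _ => Finset.sum_comm
    have e2 : ∑ x, ∑ y, ∑ z, p x y z = ∑ z, c z := by
      rw [hc, Finset.sum_comm (s := Finset.univ (α := γ))]
      exact Finset.sum_congr rfl fun x _ => Finset.sum_comm
    rw [e1, e2, sub_self]
  have s1 : ∑ x, ∑ z, Real.negMulLog (a x z)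
      = - ∑ x, ∑ y, ∑ z, p x y z * Real.log (a x z) := by
    rw [← Finset.sum_neg_distrib]
    refine Finset.sum_congr rfl fun x _ => ?_
    rw [Finset.sum_comm, ← Finset.sum_neg_distrib]
    refine Finset.sum_congr rfl fun z _ => ?_
    rw [← Finset.sum_mul, Real.negMulLog, neg_mul]
  have s2 : ∑ y, ∑ z, Real.negMulLog (b y z)
      = - ∑ x, ∑ y, ∑ z, p x y z * Real.log (b y z) := by
    rw [Finset.sum_comm (s := Finset.univ (α := α)), ← Finset.sum_neg_distrib]
    refine Finset.sum_congr rfl fun y _ => ?_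
    rw [Finset.sum_comm, ← Finset.sum_neg_distrib]
    refine Finset.sum_congr rfl fun z _ => ?_
    rw [← Finset.sum_mul, Real.negMulLog, neg_mul]
  have s3 : ∑ z, Real.negMulLog (c z)
      = - ∑ x, ∑ y, ∑ z, p x y z * Real.log (c z) := by
    have : ∀ x, ∑ y, ∑ z, p x y z * Real.log (c z) = ∑ z, a x z * Real.log (c z) := by
      intro x
      rw [Finset.sum_comm]
      exact Finset.sum_congr rfl fun z _ => (Finset.sum_mul _ _ _).symm
    rw [Finset.sum_congr rfl fun x _ => this x, Finset.sum_comm, ← Finset.sum_neg_distrib]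
    refine Finset.sum_congr rfl fun z _ => ?_
    rw [← Finset.sum_mul, Real.negMulLog, neg_mul]
  have s4 : ∑ x, ∑ y, ∑ z, Real.negMulLog (p x y z)
      = - ∑ x, ∑ y, ∑ z, p x y z * Real.log (p x y z) := by
    simp only [Real.negMulLog, neg_mul, Finset.sum_neg_distrib]
  simp only [mul_sub, mul_add, Finset.sum_sub_distrib, Finset.sum_add_distrib] at hsum
  linarith

/-- Submodularity of entropy: conditional mutual information is nonnegative. -/
lemma entropy_submodular (X : Ω → α) (Y : Ω → β) (Z : Ω → γ) :
    entropy P (fun ω => (X ω, Y ω, Z ω)) + entropy P Z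
      ≤ entropy P (fun ω => (X ω, Z ω)) + entropy P (fun ω => (Y ω, Z ω)) := by
  classical
  set T : Ω → α × β × γ := fun ω => (X ω, Y ω, Z ω) with hT
  set p : α → β → γ → ℝ := fun x y z => ((P.map T) (x, y, z)).toReal with hp
  have h := sum_negMulLog_submodular p fun x y z => ENNReal.toReal_nonneg
  have hXZ : ∀ x z, ((P.map fun ω => (X ω, Z ω)) (x, z)).toReal = ∑ y, p x y z := by
    intro x z
    rw [show (fun ω => (X ω, Z ω)) = (fun t : α × β × γ => (t.1, t.2.2)) ∘ T from rfl,
      P.toReal_map_comp_apply, Fintype.sum_prod_type, Finset.sum_eq_single x]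
    · simp [Fintype.sum_prod_type, hp]
    · intro x' _ hx'
      simp [hx'.symm]
    · simp
  have hYZ : ∀ y z, ((P.map fun ω => (Y ω, Z ω)) (y, z)).toReal = ∑ x, p x y z := by
    intro y z
    rw [show (fun ω => (Y ω, Z ω)) = (fun t : α × β × γ => t.2) ∘ T from rfl,
      P.toReal_map_comp_apply, Fintype.sum_prod_type]
    simp [hp]
  have hZ : ∀ z, ((P.map Z) z).toReal = ∑ x, ∑ y, p x y z := by
    intro z
    rw [show Z = (fun t : α × β × γ => t.2.2) ∘ T from rfl,
      P.toReal_map_comp_apply, Fintype.sum_prod_type]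
    simp [Fintype.sum_prod_type, hp]
  have hl : (0 : ℝ) < Real.log 2 := Real.log_pos one_lt_two
  simp only [entropy, ← Finset.sum_div, ← add_div]
  refine div_le_div_of_nonneg_right ?_ hl.le
  simpa only [Fintype.sum_prod_type, hXZ, hYZ, hZ] using h

/-- The image of a uniformly distributed element of a finite group under a surjective homomorphism
is uniformly distributed. -/
lemma entropy_uniformOfFintype_addMonoidHom {V U : Type} [AddGroup V] [Fintype V] [AddGroup U]
    [Fintype U] (f : V →+ U) (hf : Function.Surjective f) :
    entropy (PMF.uniformOfFintype V) f = Real.log (Fintype.card U) / Real.log 2 := by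
  classical
  set q := (PMF.uniformOfFintype V).map f with hq
  have hconst : ∀ u, q u = q 0 := by
    intro u
    obtain ⟨v, rfl⟩ := hf u
    rw [hq, PMF.map_apply, PMF.map_apply, ← (Equiv.addLeft v).tsum_eq]
    refine tsum_congr fun w => ?_
    simp [eq_comm (a := (0 : U))]
  have hsum : (Fintype.card U : ℝ≥0∞) * q 0 = 1 := by
    have := q.tsum_coe
    simpa [tsum_fintype, hconst] using this
  have hcard : (0 : ℝ) < Fintype.card U := by exact_mod_cast Fintype.card_pos
  have hreal : (q 0).toReal = (Fintype.card U : ℝ)⁻¹ := by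
    have := congrArg ENNReal.toReal hsum
    rw [ENNReal.toReal_mul, ENNReal.toReal_natCast, ENNReal.toReal_one] at this
    exact eq_inv_of_mul_eq_one_right this
  simp only [entropy, ← hq, hconst, hreal, Finset.sum_const, Finset.card_univ, nsmul_eq_mul,
    Real.negMulLog, Real.log_inv]
  field_simp

end Entropy

/-! ### Entropies of source and coded symbols -/

namespace Code

variable {K M N : ℕ} (c : Code K M) {Lw Lx : ℝ}

/-- `W_A`, the tuple of the source symbols with index in `A`. -/
def sources (A : Finset (Fin K)) (w : ∀ k, c.srcAlph k) : ∀ k : A, c.srcAlph k :=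
  fun k => w k

/-- The joint entropy `H(W_A, X_S)`. -/
noncomputable def jointEntropy (A : Finset (Fin K)) (S : Finset (Fin M)) : ℝ :=
  entropy c.law fun w => (c.sources A w, c.tuple S w)

/-- The conditional entropy `H(X_S | W_A)`, as `H(W_A, X_S) - H(W_A)`. -/
noncomputable def codedEntropy (A : Finset (Fin K)) (S : Finset (Fin M)) : ℝ :=
  c.jointEntropy A S - c.jointEntropy A ∅

variable {c}

lemma sources_eq_iff {A : Finset (Fin K)} {w w' : ∀ k, c.srcAlph k} :
    c.sources A w = c.sources A w' ↔ ∀ k ∈ A, w k = w' k := by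
  simp [funext_iff, sources]

lemma tuple_eq_iff {S : Finset (Fin M)} {w w' : ∀ k, c.srcAlph k} :
    c.tuple S w = c.tuple S w' ↔ ∀ m ∈ S, c.enc m w = c.enc m w' := by
  simp [funext_iff, tuple]

lemma jointEntropy_mono {A A' : Finset (Fin K)} {S S' : Finset (Fin M)} (hA : A ⊆ A')
    (hS : S ⊆ S') : c.jointEntropy A S ≤ c.jointEntropy A' S' := by
  refine entropy_le_of_determined _ _ _ fun w w' => ?_
  simp only [Prod.mk.injEq, sources_eq_iff, tuple_eq_iff]
  exact fun h => ⟨fun k hk => h.1 k (hA hk), fun m hm => h.2 m (hS hm)⟩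

lemma jointEntropy_submodular {A A' B C : Finset (Fin K)} {S S' T U : Finset (Fin M)}
    (hB : B ⊆ A ∪ A') (hU : U ⊆ S ∪ S') (hCA : C ⊆ A) (hCA' : C ⊆ A') (hTS : T ⊆ S)
    (hTS' : T ⊆ S') :
    c.jointEntropy B U + c.jointEntropy C T ≤ c.jointEntropy A S + c.jointEntropy A' S' := by
  have h := entropy_submodular c.law (fun w => (c.sources A w, c.tuple S w))
    (fun w => (c.sources A' w, c.tuple S' w)) (fun w => (c.sources C w, c.tuple T w))
  have h1 : c.jointEntropy B U ≤ entropy c.law (fun w => ((c.sources A w, c.tuple S w),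
      (c.sources A' w, c.tuple S' w), (c.sources C w, c.tuple T w))) := by
    refine entropy_le_of_determined _ _ _ fun w w' => ?_
    simp only [Prod.mk.injEq, sources_eq_iff, tuple_eq_iff]
    rintro ⟨⟨h1, h2⟩, ⟨h3, h4⟩, -⟩
    exact ⟨fun k hk => (Finset.mem_union.1 (hB hk)).elim (h1 k) (h3 k),
      fun m hm => (Finset.mem_union.1 (hU hm)).elim (h2 m) (h4 m)⟩
  have h2 : entropy c.law (fun w => ((c.sources A w, c.tuple S w),
      (c.sources C w, c.tuple T w))) ≤ c.jointEntropy A S := by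
    refine entropy_le_of_determined _ _ _ fun w w' => ?_
    simp only [Prod.mk.injEq, sources_eq_iff, tuple_eq_iff]
    rintro ⟨h1, h2⟩
    exact ⟨⟨h1, h2⟩, fun k hk => h1 k (hCA hk), fun m hm => h2 m (hTS hm)⟩
  have h3 : entropy c.law (fun w => ((c.sources A' w, c.tuple S' w),
      (c.sources C w, c.tuple T w))) ≤ c.jointEntropy A' S' := by
    refine entropy_le_of_determined _ _ _ fun w w' => ?_
    simp only [Prod.mk.injEq, sources_eq_iff, tuple_eq_iff]
    rintro ⟨h1, h2⟩
    exact ⟨⟨h1, h2⟩, fun k hk => h1 k (hCA' hk), fun m hm => h2 m (hTS' hm)⟩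
  have h4 : c.jointEntropy C T = entropy c.law (fun w => (c.sources C w, c.tuple T w)) := rfl
  linarith

lemma jointEntropy_empty : c.jointEntropy ∅ ∅ = 0 :=
  entropy_eq_zero_of_subsingleton _ _

lemma jointEntropy_singleton_empty (k : Fin K) :
    c.jointEntropy {k} ∅ = entropy c.law fun w => w k := by
  refine entropy_congr_of_determined _ _ _ fun w w' => ?_
  simp [sources_eq_iff, tuple_eq_iff]

lemma jointEntropy_empty_left (S : Finset (Fin M)) :
    c.jointEntropy ∅ S = entropy c.law (c.tuple S) := by
  refine entropy_congr_of_determined _ _ _ fun w w' => ?_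
  simp [sources_eq_iff, tuple_eq_iff]

lemma jointEntropy_univ (S : Finset (Fin M)) :
    c.jointEntropy Finset.univ S = entropy c.law fun w => w := by
  refine entropy_congr_of_determined _ _ _ fun w w' => ?_
  simp only [sources_eq_iff, tuple_eq_iff, Prod.mk.injEq, Finset.mem_univ, true_imp_iff]
  exact ⟨fun h => h ▸ ⟨fun _ => rfl, fun _ _ => rfl⟩, fun h => funext h.1⟩

lemma codedEntropy_empty (A : Finset (Fin K)) : c.codedEntropy A ∅ = 0 := sub_self _

lemma codedEntropy_mono {A : Finset (Fin K)} {S S' : Finset (Fin M)} (hS : S ⊆ S') :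
    c.codedEntropy A S ≤ c.codedEntropy A S' :=
  sub_le_sub_right (jointEntropy_mono subset_rfl hS) _

lemma codedEntropy_nonneg (A : Finset (Fin K)) (S : Finset (Fin M)) : 0 ≤ c.codedEntropy A S :=
  sub_nonneg.2 (jointEntropy_mono subset_rfl (Finset.empty_subset S))

lemma codedEntropy_submodular {A : Finset (Fin K)} {S S' T U : Finset (Fin M)}
    (hU : U ⊆ S ∪ S') (hTS : T ⊆ S) (hTS' : T ⊆ S') :
    c.codedEntropy A U + c.codedEntropy A T ≤ c.codedEntropy A S + c.codedEntropy A S' := by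
  have := jointEntropy_submodular (c := c) (A := A) (A' := A) (B := A) (C := A)
    Finset.subset_union_left hU subset_rfl subset_rfl hTS hTS'
  simp only [codedEntropy]
  linarith

/-- Conditioning on more source symbols does not increase `H(X_{S'} | X_S)`. -/
lemma codedEntropy_sub_anti {A A' : Finset (Fin K)} {S S' : Finset (Fin M)} (hA : A ⊆ A')
    (hS : S ⊆ S') :
    c.codedEntropy A' S' - c.codedEntropy A' S ≤ c.codedEntropy A S' - c.codedEntropy A S := by
  have := jointEntropy_submodular (c := c) (A := A') (A' := A) (B := A') (C := A) (S := S)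
    (S' := S') (T := S) (U := S') Finset.subset_union_left Finset.subset_union_right hA subset_rfl
    subset_rfl hS
  simp only [codedEntropy]
  linarith

lemma codedEntropy_le_sum (A : Finset (Fin K)) (S : Finset (Fin M)) :
    c.codedEntropy A S ≤ ∑ m ∈ S, c.codedEntropy A {m} := by
  induction S using Finset.induction_on with
  | empty => simp [codedEntropy_empty]
  | insert m S hm ih =>
    rw [Finset.sum_insert hm]
    have := codedEntropy_submodular (c := c) (A := A) (S := {m}) (S' := S) (T := ∅)
      (U := insert m S) (by simp) (by simp) (by simp)
    rw [codedEntropy_empty] at this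
    linarith

lemma codedEntropy_le_card_mul {A : Finset (Fin K)} {S : Finset (Fin M)} {B : ℝ}
    (hB : ∀ m, c.codedEntropy A {m} ≤ B) : c.codedEntropy A S ≤ S.card * B := by
  refine (codedEntropy_le_sum A S).trans ?_
  simpa using Finset.sum_le_sum fun m (_ : m ∈ S) => hB m

namespace IsLDC

variable (h : c.IsLDC N Lw Lx)
include h

lemma jointEntropy_sources (A : Finset (Fin K)) : c.jointEntropy A ∅ = A.card * Lw := by
  have hle : ∀ B : Finset (Fin K), c.jointEntropy B ∅ ≤ B.card * Lw := by
    intro B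
    induction B using Finset.induction_on with
    | empty => simp [jointEntropy_empty]
    | insert k B hk ih =>
      have := jointEntropy_submodular (c := c) (A := {k}) (A' := B) (B := insert k B) (C := ∅)
        (S := ∅) (S' := ∅) (T := ∅) (U := ∅) (by simp) (by simp) (by simp) (by simp) (by simp)
        (by simp)
      rw [jointEntropy_empty, jointEntropy_singleton_empty, h.source_size] at this
      rw [Finset.card_insert_of_notMem hk]
      push_cast
      linarith
  refine le_antisymm (hle A) ?_
  have h1 := jointEntropy_submodular (c := c) (A := A) (A' := Aᶜ) (B := Finset.univ) (C := ∅)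
    (S := ∅) (S' := ∅) (T := ∅) (U := ∅) (by simp) (by simp) (by simp) (by simp) (by simp)
    (by simp)
  rw [jointEntropy_empty, jointEntropy_univ, h.indep, Finset.sum_congr rfl fun k _ =>
    h.source_size k, Finset.sum_const, nsmul_eq_mul, Finset.card_univ,
    ← Finset.card_add_card_compl A] at h1
  have h2 := hle Aᶜ
  push_cast at h1
  linarith

lemma source_size_nonneg (hK : 1 ≤ K) : 0 ≤ Lw := by
  have := jointEntropy_mono (c := c) (Finset.empty_subset {(⟨0, hK⟩ : Fin K)})
    (Finset.empty_subset ∅)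
  rw [h.jointEntropy_sources, h.jointEntropy_sources] at this
  simpa using this

lemma codedEntropy_singleton (m : Fin M) : c.codedEntropy ∅ {m} = Lx := by
  rw [codedEntropy, jointEntropy_empty, sub_zero, ← h.coded_size m]
  refine entropy_congr_of_determined _ _ _ fun w w' => ?_
  simp [sources_eq_iff, tuple_eq_iff]

/-- Adding a source symbol `W_k` to the condition costs exactly `Lw` bits for a set of coded
symbols that decodes `W_k`. -/
lemma codedEntropy_decodingSet {A : Finset (Fin K)} {k : Fin K} (hk : k ∉ A)
    {S : Finset (Fin M)} (hS : S ∈ c.dec k) :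
    c.codedEntropy A S = Lw + c.codedEntropy (insert k A) S := by
  have h1 : c.jointEntropy {k} S = c.jointEntropy ∅ S := by
    rw [jointEntropy_empty_left, ← sub_eq_zero, ← h.decodable k S hS, condEntropy]
    congr 1
    refine entropy_congr_of_determined _ _ _ fun w w' => ?_
    simp [sources_eq_iff]
  have h2 := jointEntropy_submodular (c := c) (A := {k}) (A' := A) (B := insert k A) (C := ∅)
    (S := S) (S' := S) (T := S) (U := S) (by simp) (by simp) (by simp) (by simp) (by simp)
    (by simp)
  have h3 := jointEntropy_mono (c := c) (Finset.subset_insert k A) (subset_refl S)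
  rw [codedEntropy, codedEntropy, h.jointEntropy_sources, h.jointEntropy_sources,
    Finset.card_insert_of_notMem hk]
  push_cast
  linarith

end IsLDC

/-! ### The recursive bounds on conditional entropies -/

/-- The upper bound on `H(X_m | W_A)` for `|A| = j` in a universal code, obtained from `H(X_m) = Lx`
by the recursion `b (j + 1) = N * b j - Lw`. -/
def entropyBound (N : ℕ) (Lw Lx : ℝ) (j : ℕ) : ℝ :=
  (N : ℝ) ^ j * Lx - (∑ i ∈ Finset.range j, (N : ℝ) ^ i) * Lw

lemma entropyBound_succ (N : ℕ) (Lw Lx : ℝ) (j : ℕ) :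
    entropyBound N Lw Lx (j + 1) = N * entropyBound N Lw Lx j - Lw := by
  rw [entropyBound, entropyBound, geom_sum_succ]
  ring

namespace IsLDC

variable (h : c.IsLDC N Lw Lx) (hu : c.IsUniversal)
include h hu

lemma codedEntropy_le_entropyBound (A : Finset (Fin K)) (m : Fin M) :
    c.codedEntropy A {m} ≤ entropyBound N Lw Lx A.card := by
  induction A using Finset.induction_on generalizing m with
  | empty => simp [h.codedEntropy_singleton, entropyBound]
  | insert k A hk ih =>
    obtain ⟨S, hS, hmS⟩ := hu m k
    have h1 := h.codedEntropy_decodingSet hk hS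
    have h2 := codedEntropy_mono (c := c) (A := insert k A) (Finset.singleton_subset_iff.2 hmS)
    have h3 := codedEntropy_le_card_mul (S := S) ih
    rw [h.dec_card k S hS] at h3
    rw [Finset.card_insert_of_notMem hk, entropyBound_succ]
    linarith

lemma entropyBound_nonneg [NeZero M] {j : ℕ} (hj : j ≤ K) : 0 ≤ entropyBound N Lw Lx j := by
  obtain ⟨A, -, rfl⟩ := Finset.exists_subset_card_eq (s := (Finset.univ : Finset (Fin K)))
    (n := j) (by simpa using hj)
  exact (codedEntropy_nonneg A {0}).trans (h.codedEntropy_le_entropyBound hu A 0)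

/-- The upper bounds on `H(X_m | W_A)` are attained up to the gap `entropyBound N Lw Lx K`, which is
the value of the last one. -/
lemma entropyBound_sub_le_codedEntropy (A : Finset (Fin K)) (m : Fin M) :
    entropyBound N Lw Lx A.card - entropyBound N Lw Lx K ≤ c.codedEntropy A {m} := by
  induction hn : K - A.card generalizing A with
  | zero =>
    have hA : A.card = K :=
      le_antisymm (by simpa using A.card_le_univ) (Nat.sub_eq_zero_iff_le.1 hn)
    rw [hA, sub_self]
    exact codedEntropy_nonneg A {m}
  | succ n ih =>
    obtain ⟨k, hk⟩ : ∃ k, k ∉ A := by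
      by_contra! hall
      rw [(Finset.eq_univ_iff_forall.2 hall), Finset.card_univ, Fintype.card_fin] at hn
      omega
    have h0 := ih (insert k A) (by rw [Finset.card_insert_of_notMem hk]; omega)
    obtain ⟨S, hS, hmS⟩ := hu m k
    have h1 := h.codedEntropy_decodingSet hk hS
    have h2 := codedEntropy_mono (c := c) (A := insert k A) (Finset.singleton_subset_iff.2 hmS)
    have h3 := codedEntropy_le_sum (c := c) A S
    rw [← Finset.add_sum_erase S _ hmS] at h3
    have h4 := Finset.sum_le_sum fun x (_ : x ∈ S.erase m) =>
      h.codedEntropy_le_entropyBound hu A x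
    rw [Finset.sum_const, nsmul_eq_mul, Finset.card_erase_of_mem hmS, h.dec_card k S hS,
      Nat.cast_sub (by rw [← h.dec_card k S hS]; exact Finset.card_pos.2 ⟨m, hmS⟩)] at h4
    rw [Finset.card_insert_of_notMem hk, entropyBound_succ] at h0
    push_cast at h4
    linarith

/-- A decoding set is almost determined by each of its members and the source symbol that it
decodes. -/
lemma codedEntropy_decodingSet_le {A : Finset (Fin K)} {k : Fin K} (hk : k ∉ A)
    {S : Finset (Fin M)} (hS : S ∈ c.dec k) {m : Fin M} :
    c.codedEntropy (insert k A) S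
      ≤ c.codedEntropy (insert k A) {m} + entropyBound N Lw Lx K := by
  have h1 := h.codedEntropy_decodingSet hk hS
  have h2 := codedEntropy_le_card_mul (S := S) (h.codedEntropy_le_entropyBound hu A)
  have h3 := h.entropyBound_sub_le_codedEntropy hu (insert k A) m
  rw [Finset.card_insert_of_notMem hk, entropyBound_succ] at h3
  rw [h.dec_card k S hS] at h2
  linarith

/-- Two members of a decoding set of `W_k` are almost independent given source symbols other than
`W_k`. -/
lemma two_mul_entropyBound_le {A : Finset (Fin K)} {k : Fin K} (hk : k ∉ A)
    {S : Finset (Fin M)} (hS : S ∈ c.dec k) {x y : Fin M} (hx : x ∈ S) (hy : y ∈ S)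
    (hxy : x ≠ y) :
    2 * entropyBound N Lw Lx A.card - entropyBound N Lw Lx K ≤ c.codedEntropy A {x, y} := by
  have h1 := h.codedEntropy_decodingSet hk hS
  have h2 := codedEntropy_mono (c := c) (A := insert k A) (Finset.singleton_subset_iff.2 hx)
  have h3 := h.entropyBound_sub_le_codedEntropy hu (insert k A) x
  rw [Finset.card_insert_of_notMem hk, entropyBound_succ] at h3
  have hsub : ({x, y} : Finset (Fin M)) ⊆ S := by
    simp [Finset.insert_subset_iff, hx, hy]
  have h4 := codedEntropy_submodular (c := c) (A := A) (S := {x, y}) (S' := S \ {x, y}) (T := ∅)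
    (U := S) (by rw [Finset.union_sdiff_of_subset hsub]) (by simp) (by simp)
  have h5 := codedEntropy_le_card_mul (S := S \ {x, y}) (h.codedEntropy_le_entropyBound hu A)
  rw [codedEntropy_empty] at h4
  have h6 := Finset.card_sdiff_add_card_eq_card hsub
  rw [Finset.card_pair hxy, h.dec_card k S hS] at h6
  have h7 : ((S \ {x, y}).card : ℝ) = N - 2 := by
    rw [← h6]; push_cast; ring
  rw [h7] at h5
  linarith

end IsLDC

/-! ### Decoding trees -/

/-- The indices `π i` of the source symbols that are decoded at depth `d` or below in a tree for
the order `π`. -/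
def tailSources (π : Equiv.Perm (Fin K)) (d : ℕ) : Finset (Fin K) :=
  Finset.univ.filter fun k => d ≤ (π.symm k).val

lemma tailSources_anti (π : Equiv.Perm (Fin K)) {d d' : ℕ} (hd : d ≤ d') :
    tailSources π d' ⊆ tailSources π d := by
  intro k
  simp only [tailSources, Finset.mem_filter, Finset.mem_univ, true_and]
  exact hd.trans

lemma notMem_tailSources (π : Equiv.Perm (Fin K)) {d : ℕ} (hd : d < K) :
    π ⟨d, hd⟩ ∉ tailSources π (d + 1) := by
  simp [tailSources]

lemma tailSources_eq_insert (π : Equiv.Perm (Fin K)) {d : ℕ} (hd : d < K) :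
    tailSources π d = insert (π ⟨d, hd⟩) (tailSources π (d + 1)) := by
  ext k
  obtain ⟨i, rfl⟩ := π.surjective k
  simp only [tailSources, Finset.mem_filter, Finset.mem_univ, true_and, Finset.mem_insert,
    Equiv.symm_apply_apply, EmbeddingLike.apply_eq_iff_eq, Fin.ext_iff]
  omega

lemma card_tailSources (π : Equiv.Perm (Fin K)) {d : ℕ} (hd : d ≤ K) :
    (tailSources π d).card = K - d := by
  induction hn : K - d generalizing d with
  | zero =>
    rw [Finset.card_eq_zero, tailSources, Finset.filter_eq_empty_iff]
    intro k _
    have := (π.symm k).isLt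
    omega
  | succ n ih =>
    rw [tailSources_eq_insert π (by omega : d < K), Finset.card_insert_of_notMem
      (notMem_tailSources π _), ih (by omega) (by omega)]

/-- Every order of the source symbols has a decoding tree in a universal code with at least one
coded symbol. -/
lemma IsLDC.exists_isDecodingTree [NeZero M] (h : c.IsLDC N Lw Lx) (hu : c.IsUniversal)
    (π : Equiv.Perm (Fin K)) : ∃ label : List (Fin N) → Fin M, c.IsDecodingTree π label := by
  classical
  have hex : ∀ (m : Fin M) (k : Fin K), ∃ f : Fin N → Fin M,
      Finset.univ.image f ∈ c.dec k ∧ ∃ n, f n = m := by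
    intro m k
    obtain ⟨S, hS, hm⟩ := hu m k
    let e : Fin N ≃ S := (Finset.equivFinOfCardEq (h.dec_card k S hS)).symm
    refine ⟨fun n => e n, ?_, e.symm ⟨m, hm⟩, by simp⟩
    convert hS
    ext x
    simp only [Finset.mem_image, Finset.mem_univ, true_and]
    exact ⟨fun ⟨n, hn⟩ => hn ▸ (e n).2, fun hx => ⟨e.symm ⟨x, hx⟩, by simp⟩⟩
  choose f hf hf' using hex
  let label : List (Fin N) → Fin M := fun v => v.rec 0 fun n v m =>
    if hv : v.length < K then f m (π ⟨v.length, hv⟩) n else 0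
  refine ⟨label, fun v hv => ?_⟩
  have hlabel : (fun n => label (n :: v)) = f (label v) (π ⟨v.length, hv⟩) := by
    funext n
    exact dif_pos hv
  rw [hlabel]
  refine ⟨hf _ _, ?_⟩
  obtain ⟨n, hn⟩ := hf' (label v) (π ⟨v.length, hv⟩)
  exact ⟨n, (congrFun hlabel n).trans hn⟩

namespace IsLDC

variable (h : c.IsLDC N Lw Lx) (hu : c.IsUniversal) {π : Equiv.Perm (Fin K)}
  {label : List (Fin N) → Fin M} (ht : c.IsDecodingTree π label)

include h ht in
lemma label_cons_injective {v : List (Fin N)} (hv : v.length < K) :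
    Function.Injective fun n => label (n :: v) := by
  have hcard := h.dec_card _ _ (ht v hv).1
  rw [← Set.injOn_univ, ← Finset.coe_univ, ← Finset.card_image_iff]
  simpa using hcard

include h hu ht

/-- Each step down the tree loses at most the gap, so a node almost determines its descendants given
the source symbols decoded below it. -/
lemma codedEntropy_descendant_le (v w : List (Fin N)) (hw : (w ++ v).length ≤ K) :
    c.codedEntropy (tailSources π v.length) {label v, label (w ++ v)}
      ≤ c.codedEntropy (tailSources π v.length) {label v}
        + w.length * entropyBound N Lw Lx K := by
  induction w with
  | nil => simp
  | cons n w ih =>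
    have hlt : (w ++ v).length < K := by rw [List.cons_append, List.length_cons] at hw; omega
    have h1 := ih hlt.le
    obtain ⟨hS, n', hn'⟩ := ht (w ++ v) hlt
    have h2 := h.codedEntropy_decodingSet_le hu (notMem_tailSources π hlt) hS
      (m := label (w ++ v))
    rw [← tailSources_eq_insert] at h2
    have hsub : ({label (w ++ v), label (n :: (w ++ v))} : Finset (Fin M))
        ⊆ Finset.univ.image fun n => label (n :: (w ++ v)) := by
      simp [Finset.insert_subset_iff, ← hn']
    have h3 := codedEntropy_mono (c := c) (A := tailSources π (w ++ v).length) hsub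
    have h4 := codedEntropy_sub_anti (c := c)
      (tailSources_anti π (by simp : v.length ≤ (w ++ v).length))
      (by simp : ({label (w ++ v)} : Finset (Fin M)) ⊆ {label (w ++ v), label (n :: (w ++ v))})
    have h5 := codedEntropy_submodular (c := c) (A := tailSources π v.length)
      (S := {label v, label (w ++ v)}) (S' := {label (w ++ v), label (n :: (w ++ v))})
      (T := {label (w ++ v)}) (U := {label v, label (n :: (w ++ v))})
      (by intro x; simp; tauto) (by simp) (by simp)
    rw [List.length_cons, List.cons_append]
    push_cast
    linarith

end IsLDC

lemma _root_.List.exists_append_cons_of_ne {α : Type*} {u v : List α} (hl : u.length = v.length)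
    (hne : u ≠ v) :
    ∃ (u' v' a : List α) (x y : α), u = u' ++ x :: a ∧ v = v' ++ y :: a ∧ x ≠ y := by
  induction u generalizing v with
  | nil => exact absurd (List.length_eq_zero_iff.1 hl.symm).symm hne
  | cons x u ih =>
    obtain ⟨y, v, rfl⟩ := List.exists_cons_of_length_pos (by rw [← hl]; simp : 0 < v.length)
    by_cases huv : u = v
    · subst huv
      exact ⟨[], [], u, x, y, rfl, rfl, fun hxy => hne (hxy ▸ rfl)⟩
    · obtain ⟨u', v', a, x', y', rfl, rfl, hxy⟩ := ih (by simpa using hl) huv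
      exact ⟨x :: u', y :: v', a, x', y', rfl, rfl, hxy⟩

/-- If a leaf of a decoding tree is a function of another leaf, then the code misses the upper bound
on the rate by a definite amount. -/
lemma IsLDC.source_size_le_of_condEntropy_eq_zero (h : c.IsLDC N Lw Lx) (hu : c.IsUniversal)
    {π : Equiv.Perm (Fin K)} {label : List (Fin N) → Fin M} (ht : c.IsDecodingTree π label)
    {u v : List (Fin N)} (hul : u.length = K) (hvl : v.length = K) (huv : u ≠ v)
    (h0 : condEntropy c.law (c.enc (label u)) (c.enc (label v)) = 0) :
    Lw ≤ N * (2 * K + 1) * entropyBound N Lw Lx K := by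
  have : NeZero M := ⟨fun hM => by subst hM; exact (label []).elim0⟩
  obtain ⟨u', v', a, x, y, rfl, rfl, hxy⟩ := List.exists_append_cons_of_ne
    (hul.trans hvl.symm) huv
  have hd : a.length < K := by
    rw [← hul]; simp; omega
  set b := entropyBound N Lw Lx with hb
  set A := tailSources π (a.length + 1) with hA
  have hAcard : A.card + 1 + a.length = K := by
    rw [hA, card_tailSources π hd]; omega
  have hδ : 0 ≤ b K := h.entropyBound_nonneg hu le_rfl
  set p := label (x :: a) with hp
  set q := label (y :: a) with hq
  set r := label (u' ++ x :: a) with hr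
  set s := label (v' ++ y :: a) with hs
  have hpq : p ≠ q := fun hpq => hxy (h.label_cons_injective ht hd hpq)
  have hind := h.two_mul_entropyBound_le hu (notMem_tailSources π hd) (ht a hd).1
    (Finset.mem_image_of_mem _ (Finset.mem_univ x)) (Finset.mem_image_of_mem _ (Finset.mem_univ y))
    hpq
  have hpr := h.codedEntropy_descendant_le hu ht (x :: a) u' hul.le
  have hqs := h.codedEntropy_descendant_le hu ht (y :: a) v' hvl.le
  simp only [List.length_cons, ← hA, ← hp, ← hq, ← hr, ← hs, ← hb] at hpr hqs
  have hu'K : (u'.length : ℝ) * b K = A.card * b K := by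
    congr 2; simp at hul; omega
  have hv'K : (v'.length : ℝ) * b K = A.card * b K := by
    congr 2; simp at hvl; omega
  rw [hu'K] at hpr
  rw [hv'K] at hqs
  have h1 := h.codedEntropy_le_entropyBound hu A p
  have h2 := h.codedEntropy_le_entropyBound hu A q
  have h3 := h.entropyBound_sub_le_codedEntropy hu A r
  have h4 := h.entropyBound_sub_le_codedEntropy hu A s
  have h5 := h.codedEntropy_le_entropyBound hu A s
  -- `X_r` is a function of `X_s`, also given `W_A`
  have hrs : c.codedEntropy A {r, s} ≤ c.codedEntropy A {s} := by
    have e1 : c.codedEntropy ∅ {r, s} = c.codedEntropy ∅ {s} := by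
      rw [h.codedEntropy_singleton, codedEntropy, jointEntropy_empty, sub_zero, ← h.coded_size s,
        ← sub_eq_zero, ← h0, condEntropy]
      congr 1
      refine entropy_congr_of_determined _ _ _ fun w w' => ?_
      simp [sources_eq_iff, tuple_eq_iff]
    have e2 := codedEntropy_sub_anti (c := c) (Finset.empty_subset A)
      (by simp : ({s} : Finset (Fin M)) ⊆ {r, s})
    linarith
  -- the leaves almost determine their ancestors `p` and `q`, which are almost independent
  have h6 := codedEntropy_submodular (c := c) (A := A) (S := {r, s}) (S' := {p, r}) (T := {r})
    (U := {p, r, s}) (by intro x; simp; tauto) (by simp) (by simp)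
  have h7 := codedEntropy_submodular (c := c) (A := A) (S := {p, r, s}) (S' := {q, s}) (T := {s})
    (U := {p, q}) (by intro x; simp; tauto) (by simp) (by simp)
  have hmain : b A.card ≤ (2 * A.card + 3) * b K := by
    linarith
  have hrec : b (A.card + 1) = N * b A.card - Lw := entropyBound_succ N Lw Lx A.card
  have hpos : 0 ≤ b (A.card + 1) := h.entropyBound_nonneg hu (by omega)
  have hcardK : (A.card : ℝ) + 1 ≤ K := by exact_mod_cast (by omega : A.card + 1 ≤ K)
  calc Lw ≤ N * b A.card := by linarith
    _ ≤ N * ((2 * A.card + 3) * b K) := mul_le_mul_of_nonneg_left hmain (Nat.cast_nonneg N)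
    _ ≤ N * ((2 * K + 1) * b K) := by
        refine mul_le_mul_of_nonneg_left (mul_le_mul_of_nonneg_right ?_ hδ) (Nat.cast_nonneg N)
        linarith
    _ = _ := by ring

end Code

/-! ### Linear codes with uniform sources -/

lemma entropy_uniformOfFintype_of_card_eq_two_pow {V U : Type} [AddGroup V] [Fintype V]
    [AddGroup U] [Fintype U] (f : V →+ U) (hf : Function.Surjective f) {n : ℕ}
    (hn : Fintype.card U = 2 ^ n) :
    entropy (PMF.uniformOfFintype V) f = n := by
  rw [entropy_uniformOfFintype_addMonoidHom f hf, hn]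
  push_cast
  rw [Real.log_pow]
  exact mul_div_cancel_right₀ _ (Real.log_pos one_lt_two).ne'

lemma Code.linear_isLDC {K M N a b : ℕ}
    {E : Fin M → (Fin K → Fin a → ZMod 2) →ₗ[ZMod 2] (Fin b → ZMod 2)}
    {dec : Fin K → Finset (Finset (Fin M))} (hE : ∀ m, Function.Surjective (E m))
    (hne : ∀ k, (dec k).Nonempty) (hcard : ∀ k, ∀ S ∈ dec k, S.card = N)
    (hdec : ∀ k, ∀ S ∈ dec k, ∀ w w', (∀ m ∈ S, E m w = E m w') → w k = w' k) :
    (Code.linear E dec).IsLDC N a b := by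
  have hsrc : ∀ k : Fin K, entropy (Code.linear E dec).law (fun w => w k) = a := fun k =>
    entropy_uniformOfFintype_of_card_eq_two_pow (V := Fin K → Fin a → ZMod 2)
      (Pi.evalAddMonoidHom (fun _ : Fin K => Fin a → ZMod 2) k)
      (Function.surjective_eval k) (by simp)
  refine ⟨?_, hsrc, fun m => ?_, hne, hcard, fun k S hS => ?_⟩
  · rw [Finset.sum_congr rfl fun k _ => hsrc k]
    have := entropy_uniformOfFintype_of_card_eq_two_pow (V := Fin K → Fin a → ZMod 2)
      (AddMonoidHom.id (Fin K → Fin a → ZMod 2)) Function.surjective_id (n := a * K)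
      (by simp [pow_mul])
    refine Eq.trans ?_ (this.trans ?_)
    · rfl
    · simp [mul_comm]
  · exact entropy_uniformOfFintype_of_card_eq_two_pow (V := Fin K → Fin a → ZMod 2)
      (E m).toAddMonoidHom (hE m) (by simp)
  · exact condEntropy_eq_zero_of_determined _ _ _ fun w w' hw =>
      hdec k S hS w w' (Code.tuple_eq_iff.1 hw)

/-! ### A perfectly smooth linear code -/

namespace SmoothCode

variable {K N M a b : ℕ}

/-- The bit `∑ k, W_k (s, g k)` of copy `s` that is queried at `g`. The source symbol `W_k` has one
bit for each copy `s` and each nonzero `x : ZMod N`, enumerated by `i`; the value at `x = 0` is read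
as `0`. -/
def queryBit (i : Fin a ≃ (Fin K → ZMod N) × {x : ZMod N // x ≠ 0}) (s g : Fin K → ZMod N) :
    (Fin K → Fin a → ZMod 2) →ₗ[ZMod 2] ZMod 2 :=
  ∑ k, if hg : g k ≠ 0 then
    LinearMap.proj (i.symm (s, ⟨g k, hg⟩)) ∘ₗ LinearMap.proj k else 0

/-- The encoder: the coded symbol with index `q` consists of the bits that the copies `s` give at
`q + s`, for all `s` with `q + s ≠ 0`. Its positions are enumerated by `g = q + s` through `j`. -/
def encoder (e : Fin M ≃ (Fin K → ZMod N))
    (i : Fin a ≃ (Fin K → ZMod N) × {x : ZMod N // x ≠ 0})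
    (j : Fin b ≃ {g : Fin K → ZMod N // g ≠ 0}) (m : Fin M) :
    (Fin K → Fin a → ZMod 2) →ₗ[ZMod 2] (Fin b → ZMod 2) :=
  LinearMap.pi fun n => queryBit i ((j n : Fin K → ZMod N) - e m) (j n)

/-- The set of the coded symbols on the line through `q` in direction `k`. -/
def line [NeZero N] (e : Fin M ≃ (Fin K → ZMod N)) (k : Fin K) (q : Fin K → ZMod N) :
    Finset (Fin M) :=
  Finset.univ.image fun t => e.symm (Function.update q k t)

variable (e : Fin M ≃ (Fin K → ZMod N)) (i : Fin a ≃ (Fin K → ZMod N) × {x : ZMod N // x ≠ 0})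
  (j : Fin b ≃ {g : Fin K → ZMod N // g ≠ 0})

lemma queryBit_apply (s g : Fin K → ZMod N) (w : Fin K → Fin a → ZMod 2) :
    queryBit i s g w = ∑ k, if hg : g k ≠ 0 then w k (i.symm (s, ⟨g k, hg⟩)) else 0 := by
  rw [queryBit, LinearMap.sum_apply]
  refine Finset.sum_congr rfl fun k _ => ?_
  split_ifs <;> simp

lemma queryBit_zero (s : Fin K → ZMod N) (w : Fin K → Fin a → ZMod 2) :
    queryBit i s 0 w = 0 := by
  simp [queryBit_apply]

lemma queryBit_sub_queryBit (s g : Fin K → ZMod N) (k : Fin K) (x : {x : ZMod N // x ≠ 0})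
    (w : Fin K → Fin a → ZMod 2) :
    queryBit i s (Function.update g k x) w - queryBit i s (Function.update g k 0) w
      = w k (i.symm (s, x)) := by
  rw [queryBit_apply, queryBit_apply, ← Finset.sum_sub_distrib, Finset.sum_eq_single k]
  · simp [x.2]
  · intro k' _ hk'
    simp [hk']
  · simp

lemma encoder_surjective (m : Fin M) : Function.Surjective (encoder e i j m) := by
  classical
  intro y
  have hex : ∀ g : {g : Fin K → ZMod N // g ≠ 0}, ∃ k, g.1 k ≠ 0 := fun g =>
    Function.ne_iff.1 g.2
  -- the bit queried at `g` is placed in one source symbol that contributes to it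
  choose κ hκ using hex
  refine ⟨fun k n => if h : (i n).1 + e m ≠ 0 then
    if κ ⟨_, h⟩ = k then y (j.symm ⟨_, h⟩) else 0 else 0, ?_⟩
  funext n
  rw [encoder, LinearMap.pi_apply, queryBit_apply, Finset.sum_eq_single (κ (j n))]
  · simp [hκ, (j n).2]
  · intro k _ hk
    simp [(j n).2, hk.symm]
  · simp

lemma queryBit_congr {w w' : Fin K → Fin a → ZMod 2} {s g : Fin K → ZMod N} {m : Fin M}
    (hm : e m = g - s) (h : encoder e i j m w = encoder e i j m w') :
    queryBit i s g w = queryBit i s g w' := by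
  by_cases hg : g = 0
  · rw [hg, queryBit_zero, queryBit_zero]
  · have := congrFun h (j.symm ⟨g, hg⟩)
    simpa [encoder, hm] using this

lemma decodable_of_line [NeZero N] (k : Fin K) (q : Fin K → ZMod N)
    {w w' : Fin K → Fin a → ZMod 2}
    (h : ∀ m ∈ line e k q, encoder e i j m w = encoder e i j m w') : w k = w' k := by
  have hbit : ∀ s t, queryBit i s (Function.update (q + s) k t) w
      = queryBit i s (Function.update (q + s) k t) w' := by
    intro s t
    refine queryBit_congr e i j (m := e.symm (Function.update q k (t - s k))) ?_
      (h _ (Finset.mem_image_of_mem _ (Finset.mem_univ _)))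
    rw [Equiv.apply_symm_apply]
    funext k'
    by_cases hk : k' = k
    · subst hk; simp
    · simp [hk]
  funext n
  have h1 := queryBit_sub_queryBit i (i n).1 (q + (i n).1) k (i n).2 w
  have h2 := queryBit_sub_queryBit i (i n).1 (q + (i n).1) k (i n).2 w'
  rw [hbit, hbit, h2] at h1
  simpa using h1.symm

lemma card_line [NeZero N] (k : Fin K) (q : Fin K → ZMod N) : (line e k q).card = N := by
  have hinj : Function.Injective fun t => e.symm (Function.update q k t) :=
    e.symm.injective.comp (Function.update_injective q k)
  rw [line, Finset.card_image_of_injective _ hinj, Finset.card_univ, ZMod.card]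

lemma mem_line_self [NeZero N] (k : Fin K) (m : Fin M) : m ∈ line e k (e m) :=
  Finset.mem_image.2 ⟨e m k, Finset.mem_univ _, by simp⟩

lemma line_eq_of_mem [NeZero N] {k : Fin K} {q : Fin K → ZMod N} {m : Fin M}
    (hm : m ∈ line e k q) : line e k q = line e k (e m) := by
  obtain ⟨t, -, rfl⟩ := Finset.mem_image.1 hm
  simp [line]

end SmoothCode

open SmoothCode in
/-- The code of length `N ^ K` whose coded symbols are indexed by `(ZMod N) ^ K` and whose decoding
sets for `W_k` are the lines in direction `k`. -/
lemma Code.exists_linear_smooth {N : ℕ} (K : ℕ) (hN : 1 ≤ N) :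
    ∃ (E : Fin (N ^ K) → (Fin K → Fin (N ^ K * (N - 1)) → ZMod 2) →ₗ[ZMod 2]
        (Fin (N ^ K - 1) → ZMod 2)) (dec : Fin K → Finset (Finset (Fin (N ^ K)))),
      (Code.linear E dec).IsLDC N ((N ^ K * (N - 1) : ℕ) : ℝ) ((N ^ K - 1 : ℕ) : ℝ) ∧
      (Code.linear E dec).IsSmooth ∧ (Code.linear E dec).IsUniversal := by
  classical
  have : NeZero N := ⟨by omega⟩
  have e : Fin (N ^ K) ≃ (Fin K → ZMod N) := (Fintype.equivFinOfCardEq (by simp)).symm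
  have i : Fin (N ^ K * (N - 1)) ≃ (Fin K → ZMod N) × {x : ZMod N // x ≠ 0} :=
    (Fintype.equivFinOfCardEq (by simp [Fintype.card_subtype_compl])).symm
  have j : Fin (N ^ K - 1) ≃ {g : Fin K → ZMod N // g ≠ 0} :=
    (Fintype.equivFinOfCardEq (by simp [Fintype.card_subtype_compl])).symm
  have hmem : ∀ (k : Fin K) (m : Fin (N ^ K)),
      line e k (e m) ∈ Finset.univ.image (line e k) := fun k m =>
    Finset.mem_image_of_mem _ (Finset.mem_univ _)
  refine ⟨encoder e i j, fun k => Finset.univ.image (line e k), ?_, ?_, ?_⟩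
  · refine Code.linear_isLDC (encoder_surjective e i j)
      (fun k => Finset.univ_nonempty.image _) ?_ ?_
    · intro k S hS
      obtain ⟨q, -, rfl⟩ := Finset.mem_image.1 hS
      exact card_line e k q
    · intro k S hS w w' h
      obtain ⟨q, -, rfl⟩ := Finset.mem_image.1 hS
      exact decodable_of_line e i j k q h
  · have key : ∀ (m : Fin (N ^ K)) (k : Fin K),
        (Finset.univ.image (line e k)).filter (fun S => m ∈ S) = {line e k (e m)} := by
      intro m k
      ext S
      rw [Finset.mem_filter, Finset.mem_singleton]
      constructor
      · rintro ⟨hS, hm⟩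
        obtain ⟨q, -, rfl⟩ := Finset.mem_image.1 hS
        exact line_eq_of_mem e hm
      · rintro rfl
        exact ⟨hmem k m, mem_line_self e k m⟩
    intro m m' k
    have h1 := congrArg Finset.card (key m k)
    have h2 := congrArg Finset.card (key m' k)
    rw [Finset.card_singleton] at h1 h2
    refine Eq.trans ?_ (h1.trans (h2.symm.trans ?_)) <;> simp only [Code.linear]
  · exact fun m k => ⟨_, hmem k m, mem_line_self e k m⟩

/-- For locality `1` the capacity is achieved by a single coded symbol that repeats all source
symbols. -/
lemma isULDCRate_one {K : ℕ} (hK : 1 ≤ K) : IsULDCRate 1 K 1 (1 / K) := by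
  refine ⟨Code.linear (a := 1) (b := K)
    (fun _ => LinearMap.pi fun k => LinearMap.proj 0 ∘ₗ LinearMap.proj k) (fun _ => {{0}}),
    (1 : ℕ), K, Code.linear_isLDC ?_ (by simp) (by simp) ?_, ?_, by exact_mod_cast hK, by simp⟩
  · exact fun _ y => ⟨fun k _ => y k, rfl⟩
  · intro k S hS w w' h
    rw [Finset.mem_singleton.1 hS] at h
    have := congrFun (h 0 (Finset.mem_singleton_self 0)) k
    funext n
    rw [Subsingleton.elim n 0]
    exact this
  · intro m k
    exact ⟨{0}, Finset.mem_singleton_self _, by simp [Subsingleton.elim m 0]⟩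

/-! ### The capacity -/

section Capacity

variable {N K M : ℕ}

lemma pow_mul_sum_one_div_pow (hN : 1 ≤ N) (K : ℕ) :
    (N : ℝ) ^ K * ∑ i ∈ Finset.range K, (1 / (N : ℝ)) ^ i
      = N * ∑ i ∈ Finset.range K, (N : ℝ) ^ i := by
  have hN' : (N : ℝ) ≠ 0 := by exact_mod_cast (by omega : N ≠ 0)
  induction K with
  | zero => simp
  | succ K ih =>
    rw [Finset.sum_range_succ, geom_sum_succ, ← ih, pow_succ, mul_add, one_div_pow]
    field_simp

lemma one_le_sum_one_div_pow (N : ℕ) (hK : 1 ≤ K) :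
    1 ≤ ∑ i ∈ Finset.range K, (1 / (N : ℝ)) ^ i := by
  refine le_of_eq_of_le ?_ (Finset.single_le_sum (f := fun i => (1 / (N : ℝ)) ^ i)
    (fun i _ => by positivity) (Finset.mem_range.2 hK))
  simp

lemma mul_entropyBound (hN : 1 ≤ N) (K : ℕ) (Lw Lx : ℝ) :
    N * Code.entropyBound N Lw Lx K
      = (N : ℝ) ^ K * (N * Lx - (∑ i ∈ Finset.range K, (1 / (N : ℝ)) ^ i) * Lw) := by
  rw [mul_sub, ← mul_assoc _ _ Lw, pow_mul_sum_one_div_pow hN, Code.entropyBound]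
  ring

lemma Code.IsLDC.length_ne_zero {c : Code K M} {Lw Lx : ℝ} (h : c.IsLDC N Lw Lx) (hN : 1 ≤ N)
    (hK : 1 ≤ K) : M ≠ 0 := by
  rintro rfl
  obtain ⟨S, hS⟩ := h.dec_nonempty ⟨0, hK⟩
  have := h.dec_card _ S hS
  rw [Finset.eq_empty_of_isEmpty S, Finset.card_empty] at this
  omega

lemma IsULDCRate.le (hN : 1 ≤ N) (hK : 1 ≤ K) {R : ℝ} (hR : IsULDCRate N K M R) :
    R ≤ N * (∑ i ∈ Finset.range K, (1 / (N : ℝ)) ^ i)⁻¹ := by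
  obtain ⟨c, Lw, Lx, h, hu, hx, rfl⟩ := hR
  have : NeZero M := ⟨h.length_ne_zero hN hK⟩
  have hQ := one_le_sum_one_div_pow N hK
  have h1 := h.entropyBound_nonneg hu le_rfl
  have h2 := mul_entropyBound hN K Lw Lx
  have hN' : (0 : ℝ) < N := by exact_mod_cast hN
  have h3 := nonneg_of_mul_nonneg_right (h2 ▸ mul_nonneg hN'.le h1) (pow_pos hN' K)
  rw [← div_eq_mul_inv, div_le_div_iff₀ hx (by linarith)]
  linarith

/-- A code that is shorter than `N ^ K` has two leaves with the same label in each decoding tree, so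
that its rate stays below the capacity by an amount that depends only on `N` and `K`. -/
lemma IsULDCRate.le_of_length_lt (hN : 1 ≤ N) (hK : 1 ≤ K) (hM : M < N ^ K) {R : ℝ}
    (hR : IsULDCRate N K M R) :
    R ≤ N / (∑ i ∈ Finset.range K, (1 / (N : ℝ)) ^ i + ((2 * K + 1) * (N : ℝ) ^ K)⁻¹) := by
  obtain ⟨c, Lw, Lx, h, hu, hx, rfl⟩ := hR
  have : NeZero M := ⟨h.length_ne_zero hN hK⟩
  obtain ⟨label, ht⟩ := h.exists_isDecodingTree hu 1
  obtain ⟨f, g, hfg, hl⟩ := Fintype.exists_ne_map_eq_of_card_lt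
    (fun f : Fin K → Fin N => label (List.ofFn f)) (by simpa using hM)
  have h1 := h.source_size_le_of_condEntropy_eq_zero hu ht (List.length_ofFn (f := f))
    (List.length_ofFn (f := g)) (fun hfg' => hfg (List.ofFn_injective hfg'))
    (by rw [hl]
        exact condEntropy_eq_zero_of_determined _ _ _ fun _ _ => id)
  have h2 := mul_entropyBound hN K Lw Lx
  have hN' : (0 : ℝ) < N := by exact_mod_cast hN
  have hQ := one_le_sum_one_div_pow N hK
  set Q := ∑ i ∈ Finset.range K, (1 / (N : ℝ)) ^ i
  have hD : 0 < (2 * K + 1) * (N : ℝ) ^ K := by positivity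
  have h3 : Lw ≤ ((2 * K + 1) * (N : ℝ) ^ K) * (N * Lx - Q * Lw) := by
    calc Lw ≤ N * (2 * K + 1) * Code.entropyBound N Lw Lx K := h1
      _ = (2 * K + 1) * (N * Code.entropyBound N Lw Lx K) := by ring
      _ = _ := by rw [h2]; ring
  rw [← inv_mul_le_iff₀ hD] at h3
  rw [div_le_div_iff₀ hx (by positivity)]
  linarith

lemma smooth_rate_eq (hN : 2 ≤ N) (hK : 1 ≤ K) :
    ((N ^ K * (N - 1) : ℕ) : ℝ) / ((N ^ K - 1 : ℕ) : ℝ)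
      = N * (∑ i ∈ Finset.range K, (1 / (N : ℝ)) ^ i)⁻¹ := by
  have h1 := pow_mul_sum_one_div_pow (by omega : 1 ≤ N) K
  have h2 := geom_sum_mul (N : ℝ) K
  have hQ := one_le_sum_one_div_pow N hK
  have hpow : 1 < N ^ K := Nat.one_lt_pow (by omega) (by omega)
  have hpow' : (1 : ℝ) < (N : ℝ) ^ K := by exact_mod_cast hpow
  rw [Nat.cast_mul, Nat.cast_sub hpow.le, Nat.cast_sub (by omega : 1 ≤ N), Nat.cast_pow,
    Nat.cast_one, ← div_eq_mul_inv, div_eq_div_iff (by linarith) (by linarith), ← h2]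
  linear_combination ((N : ℝ) - 1) * h1

lemma isULDCRate_pow (hN : 1 ≤ N) (hK : 1 ≤ K) :
    IsULDCRate N K (N ^ K) (N * (∑ i ∈ Finset.range K, (1 / (N : ℝ)) ^ i)⁻¹) := by
  rcases hN.eq_or_lt with rfl | hN2
  · simpa using isULDCRate_one hK
  · obtain ⟨E, dec, h, -, hu⟩ := Code.exists_linear_smooth K hN
    refine ⟨_, _, _, h, hu, ?_, (smooth_rate_eq hN2 hK).symm⟩
    have hpow : 1 < N ^ K := Nat.one_lt_pow (by omega) (by omega)
    exact_mod_cast (by omega : 0 < N ^ K - 1)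

lemma uldcCapacity_le (hN : 1 ≤ N) (hK : 1 ≤ K) (M : ℕ) :
    uldcCapacity N K M
      ≤ ENNReal.ofReal (N * (∑ i ∈ Finset.range K, (1 / (N : ℝ)) ^ i)⁻¹) := by
  refine sSup_le ?_
  rintro _ ⟨R, hR, rfl⟩
  exact ENNReal.ofReal_le_ofReal (hR.le hN hK)

lemma uldcCapacity_pow (hN : 1 ≤ N) (hK : 1 ≤ K) :
    uldcCapacity N K (N ^ K)
      = ENNReal.ofReal (N * (∑ i ∈ Finset.range K, (1 / (N : ℝ)) ^ i)⁻¹) :=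
  le_antisymm (uldcCapacity_le hN hK _) (le_sSup ⟨_, isULDCRate_pow hN hK, rfl⟩)

lemma uldcMaxCapacity_eq (hN : 1 ≤ N) (hK : 1 ≤ K) :
    uldcMaxCapacity N K
      = ENNReal.ofReal (N * (∑ i ∈ Finset.range K, (1 / (N : ℝ)) ^ i)⁻¹) :=
  le_antisymm (iSup_le (uldcCapacity_le hN hK))
    ((uldcCapacity_pow hN hK).ge.trans (le_iSup (uldcCapacity N K) (N ^ K)))

lemma uldcCapacity_lt (hN : 1 ≤ N) (hK : 1 ≤ K) (hM : M < N ^ K) :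
    uldcCapacity N K M < uldcMaxCapacity N K := by
  have hN' : (0 : ℝ) < N := by exact_mod_cast hN
  have hQ := one_le_sum_one_div_pow N hK
  rw [uldcMaxCapacity_eq hN hK]
  have hle : uldcCapacity N K M ≤ ENNReal.ofReal (N / (∑ i ∈ Finset.range K, (1 / (N : ℝ)) ^ i
      + ((2 * K + 1) * (N : ℝ) ^ K)⁻¹)) := by
    refine sSup_le ?_
    rintro _ ⟨R, hR, rfl⟩
    exact ENNReal.ofReal_le_ofReal (hR.le_of_length_lt hN hK hM)
  refine hle.trans_lt ((ENNReal.ofReal_lt_ofReal_iff (by positivity)).2 ?_)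
  rw [← div_eq_mul_inv]
  exact div_lt_div_of_pos_left hN' (by linarith) (lt_add_of_pos_right _ (by positivity))

end Capacity

theorem theorem2 (N K : ℕ) (hN : 1 ≤ N) (hK : 1 ≤ K) :
    -- the value of the maximal capacity
    uldcMaxCapacity N K
        = ENNReal.ofReal ((N : ℝ) * (∑ i ∈ Finset.range K, (1 / (N : ℝ)) ^ i)⁻¹) ∧
    -- the minimal length at which the capacity is maximal
    IsLeast {M : ℕ | uldcCapacity N K M = uldcMaxCapacity N K} (N ^ K) ∧
    -- the minimal length of a single universal LDC whose rate is the maximal capacity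
    IsLeast {M : ℕ | ∃ R : ℝ, IsULDCRate N K M R ∧ ENNReal.ofReal R = uldcMaxCapacity N K}
      (N ^ K) ∧
    -- the leaves of each decoding tree of a capacity achieving universal LDC are distinct
    -- coded symbols, none of which determines another
    (∀ (M : ℕ) (c : Code K M) (Lw Lx : ℝ), c.IsLDC N Lw Lx → c.IsUniversal → 0 < Lx →
      ENNReal.ofReal (Lw / Lx) = uldcMaxCapacity N K →
      ∀ (π : Equiv.Perm (Fin K)) (label : List (Fin N) → Fin M), c.IsDecodingTree π label →
      ∀ u v : List (Fin N), u.length = K → v.length = K → u ≠ v →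
        label u ≠ label v ∧
          condEntropy c.law (c.enc (label u)) (c.enc (label v)) ≠ 0) ∧
    -- a capacity achieving linear perfectly smooth LDC of minimal length
    (2 ≤ N →
      ∃ (E : Fin (N ^ K) → (Fin K → Fin (N ^ K * (N - 1)) → ZMod 2) →ₗ[ZMod 2]
          (Fin (N ^ K - 1) → ZMod 2)) (dec : Fin K → Finset (Finset (Fin (N ^ K)))),
        (Code.linear E dec).IsLDC N ((N ^ K * (N - 1) : ℕ) : ℝ) ((N ^ K - 1 : ℕ) : ℝ) ∧
        (Code.linear E dec).IsSmooth ∧ (Code.linear E dec).IsUniversal ∧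
        ENNReal.ofReal (((N ^ K * (N - 1) : ℕ) : ℝ) / ((N ^ K - 1 : ℕ) : ℝ))
          = uldcMaxCapacity N K) := by
  have hmax := uldcMaxCapacity_eq hN hK
  have hlt : ∀ M, uldcCapacity N K M = uldcMaxCapacity N K → N ^ K ≤ M := fun M hM =>
    not_lt.1 fun hMlt => (uldcCapacity_lt hN hK hMlt).ne hM
  refine ⟨hmax, ⟨(uldcCapacity_pow hN hK).trans hmax.symm, hlt⟩,
    ⟨⟨_, isULDCRate_pow hN hK, hmax.symm⟩, ?_⟩, ?_, ?_⟩
  · rintro M ⟨R, hR, hRmax⟩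
    refine hlt M (le_antisymm (le_iSup (uldcCapacity N K) M) ?_)
    rw [← hRmax]
    exact le_sSup ⟨R, hR, rfl⟩
  · intro M c Lw Lx h hu hx hrate π label ht u v hul hvl huv
    have hN' : (0 : ℝ) < N := by exact_mod_cast hN
    have hQ := one_le_sum_one_div_pow N hK
    have hC : 0 < (N : ℝ) * (∑ i ∈ Finset.range K, (1 / (N : ℝ)) ^ i)⁻¹ := by positivity
    rw [hmax, ENNReal.ofReal_eq_ofReal_iff (div_nonneg (h.source_size_nonneg hK) hx.le) hC.le]
      at hrate
    have hw : 0 < Lw := by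
      rw [div_eq_iff hx.ne'] at hrate
      exact hrate ▸ mul_pos hC hx
    -- the rate is the capacity exactly if the gap is zero
    have hgap : Code.entropyBound N Lw Lx K = 0 := by
      have h1 := mul_entropyBound hN K Lw Lx
      rw [← div_eq_mul_inv, div_eq_div_iff hx.ne' (by linarith)] at hrate
      rw [← hrate, mul_comm Lw, sub_self, mul_zero] at h1
      exact (mul_eq_zero.1 h1).resolve_left hN'.ne'
    have hne : condEntropy c.law (c.enc (label u)) (c.enc (label v)) ≠ 0 := by
      intro h0
      have h1 := h.source_size_le_of_condEntropy_eq_zero hu ht hul hvl huv h0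
      rw [hgap, mul_zero] at h1
      exact hw.not_ge h1
    refine ⟨fun hl => hne ?_, hne⟩
    rw [hl]
    exact condEntropy_eq_zero_of_determined _ _ _ fun _ _ => id
  · intro hN2
    obtain ⟨E, dec, h, hs, hu⟩ := Code.exists_linear_smooth K hN
    exact ⟨E, dec, h, hs, hu, by rw [smooth_rate_eq hN2 hK, hmax]⟩
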